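/- Let $\beta>1$ be a real number and let $T_\beta x=\beta x-\lfloor\beta x\rfloor$. For $x\in[0,1)$ and $n\ge 1$ let $\varepsilon_n(x)=\lfloor \beta\, T_\beta^{n-1}x\rfloor$ be the digits of the $\beta$-expansion of $x$, and let $\omega_n(x)=\sum_{k=1}^{n}\varepsilon_k(x)\beta^{-k}$ be its convergents; one has $x-\omega_n(x)\ge 0$. For a real number $\alpha$ consider the level set \[ L_\alpha=\Big\{x\in[0,1):\ \liminf_{n\to\infty}\frac1n\log_\beta\big(x-\omega_n(x)\big)=-\alpha\Big\}, \] where the lower limit is taken in $[-\infty,+\infty]$ and $\log_\beta 0=-\infty$. If $\alpha\ge 1$, then $L_\alpha$ has Hausdorff dimension $1/\alpha$. If $\alpha<1$, then $L_\alpha$ is empty. -/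

import Mathlib

noncomputable section

namespace BetaExpansion

/-- The β-transformation `T_β x = β x - ⌊β x⌋`. -/
def T (β x : ℝ) : ℝ := β * x - (⌊β * x⌋ : ℝ)

/-- The digits of the β-expansion, indexed from zero: `digit β x k` is `ε_{k+1}(x, β)`, that is
`ε_1(x, β) = ⌊β x⌋` and `ε_{k+1}(x, β) = ε_1(T_β^k x, β)`. -/
def digit (β x : ℝ) (k : ℕ) : ℤ := ⌊β * (T β)^[k] x⌋

/-- The convergent `ω_n(x, β) = ε_1(x, β)/β + ⋯ + ε_n(x, β)/β^n`. -/
def convergent (β x : ℝ) (n : ℕ) : ℝ :=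
  ∑ k ∈ Finset.range n, (digit β x k : ℝ) / β ^ (k + 1)

/-- The base-`β` logarithm of a nonnegative real as an extended real, with `log_β 0 = -∞`.
(It is only applied to `x - ω_n(x) ≥ 0`.) -/
def elogb (β y : ℝ) : EReal := if 0 < y then (Real.logb β y : EReal) else ⊥

/-- The level set of those `x ∈ [0,1)` with `liminf_n (1/n) log_β (x - ω_n(x)) = -α`,
the lower limit being taken in the extended reals. -/
def levelSet (β α : ℝ) : Set ℝ :=
  {x | x ∈ Set.Ico (0 : ℝ) 1 ∧
    Filter.liminf (fun n : ℕ => ((1 / (n : ℝ) : ℝ) : EReal) * elogb β (x - convergent β x n))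
      Filter.atTop = ((-α : ℝ) : EReal)}

end BetaExpansion

end

open Filter Topology MeasureTheory Set
open scoped ENNReal NNReal

namespace BetaExpansion

/-! ### Digits, remainders and convergents -/

/-! By telescoping, `x - ω_n(x) = T^n x / β^n < β^(-n)` (`sub_convergent`), which rules out `α < 1`.

Upper bound: there are `O(β^n)` convergents of order `n`. For `a < α`, a point of the level set lies
within `β^(-a n)` of one of them for infinitely many `n`, so the `d`-dimensional sums behave like `∑
β^(n (1 - a d))`, which converges once `a d > 1`.

Lower bound: take the set of `x` with `T^n x ≥ c / (n + 1)^2` for all `n`; it has positive Lebesgue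
measure for small `c`. Move digit `k` to position `p k ≤ α k`, with long blocks of zeros ending near
`α t!`. The result is again a β-expansion (`iterate_T_spread`), and its remainders have exactly the
required lower limit (`spread_mem_levelSet`). The inverse map is Hölder with exponent `1 / (α + η)`
for every `η > 0` (`exists_dist_le_dist_spread_rpow`), so the image has dimension at least `1 / (α +
η)`. -/

lemma T_mem_Ico (β x : ℝ) : T β x ∈ Ico (0 : ℝ) 1 :=
  ⟨Int.fract_nonneg (β * x), Int.fract_lt_one (β * x)⟩

lemma iterate_T_mem_Ico (β : ℝ) {x : ℝ} (hx : x ∈ Ico (0 : ℝ) 1) (n : ℕ) :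
    (T β)^[n] x ∈ Ico (0 : ℝ) 1 := by
  cases n with
  | zero => exact hx
  | succ n => rw [Function.iterate_succ_apply']; exact T_mem_Ico _ _

lemma digit_nonneg {β : ℝ} (hβ : 1 < β) {x : ℝ} (hx : x ∈ Ico (0 : ℝ) 1) (k : ℕ) :
    0 ≤ digit β x k :=
  Int.floor_nonneg.2 (mul_nonneg (by linarith) (iterate_T_mem_Ico β hx k).1)

lemma digit_div_pow {β : ℝ} (hβ : 1 < β) (x : ℝ) (k : ℕ) :
    (digit β x k : ℝ) / β ^ (k + 1)
      = (T β)^[k] x / β ^ k - (T β)^[k + 1] x / β ^ (k + 1) := by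
  have : β ≠ 0 := by linarith
  rw [Function.iterate_succ_apply', digit]
  simp only [T]
  field_simp
  ring

lemma sub_convergent {β : ℝ} (hβ : 1 < β) (x : ℝ) (n : ℕ) :
    x - convergent β x n = (T β)^[n] x / β ^ n := by
  simp only [convergent, digit_div_pow hβ]
  rw [Finset.sum_range_sub']
  simp

lemma convergent_succ (β x : ℝ) (n : ℕ) :
    convergent β x (n + 1) = convergent β x n + digit β x n / β ^ (n + 1) :=
  Finset.sum_range_succ _ _

lemma convergent_mono {β : ℝ} (hβ : 1 < β) {x : ℝ} (hx : x ∈ Ico (0 : ℝ) 1) :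
    Monotone (convergent β x) := by
  refine monotone_nat_of_le_succ fun n => ?_
  have : (0 : ℝ) ≤ digit β x n := by exact_mod_cast digit_nonneg hβ hx n
  rw [convergent_succ]
  have : 0 ≤ (digit β x n : ℝ) / β ^ (n + 1) := by positivity
  linarith

lemma convergent_le {β : ℝ} (hβ : 1 < β) {x : ℝ} (hx : x ∈ Ico (0 : ℝ) 1) (n : ℕ) :
    convergent β x n ≤ x := by
  have h := sub_convergent hβ x n
  have : 0 ≤ (T β)^[n] x / β ^ n := by
    have := (iterate_T_mem_Ico β hx n).1
    positivity
  linarith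

lemma convergent_nonneg {β : ℝ} (hβ : 1 < β) {x : ℝ} (hx : x ∈ Ico (0 : ℝ) 1) (n : ℕ) :
    0 ≤ convergent β x n := by
  have := convergent_mono hβ hx (Nat.zero_le n)
  simpa [convergent] using this

lemma convergent_congr (β : ℝ) {x y : ℝ} {n : ℕ} (h : ∀ k < n, digit β x k = digit β y k) :
    convergent β x n = convergent β y n := by
  refine Finset.sum_congr rfl fun k hk => ?_
  rw [h k (Finset.mem_range.1 hk)]

lemma hasSum_digit {β : ℝ} (hβ : 1 < β) {x : ℝ} (hx : x ∈ Ico (0 : ℝ) 1) (n : ℕ) :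
    HasSum (fun k => (digit β x (n + k) : ℝ) / β ^ (n + k + 1)) ((T β)^[n] x / β ^ n) := by
  have h0 : ∀ k, 0 ≤ (digit β x (n + k) : ℝ) / β ^ (n + k + 1) := fun k => by
    have : (0 : ℝ) ≤ digit β x (n + k) := by exact_mod_cast digit_nonneg hβ hx (n + k)
    positivity
  rw [hasSum_iff_tendsto_nat_of_nonneg h0]
  have hs : ∀ N, ∑ k ∈ Finset.range N, (digit β x (n + k) : ℝ) / β ^ (n + k + 1)
      = (T β)^[n] x / β ^ n - (T β)^[n + N] x / β ^ (n + N) := fun N => by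
    simp only [digit_div_pow hβ]
    exact Finset.sum_range_sub' (fun k => (T β)^[n + k] x / β ^ (n + k)) N
  simp only [hs]
  have hlim : Tendsto (fun N => (T β)^[n + N] x / β ^ (n + N)) atTop (𝓝 0) := by
    refine squeeze_zero (g := fun N => (1 / β) ^ N) (fun N => ?_) (fun N => ?_) ?_
    · have := (iterate_T_mem_Ico β hx (n + N)).1
      positivity
    · rw [one_div_pow]
      have h1 := (iterate_T_mem_Ico β hx (n + N)).2.le
      have h2 : β ^ N ≤ β ^ (n + N) := pow_le_pow_right₀ hβ.le (by omega)
      gcongr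
    · exact tendsto_pow_atTop_nhds_zero_of_lt_one (by positivity)
        ((div_lt_one (by linarith)).2 hβ)
  simpa using hlim.const_sub ((T β)^[n] x / β ^ n)

lemma eq_of_digit_eq {β : ℝ} (hβ : 1 < β) {x y : ℝ} (hx : x ∈ Ico (0 : ℝ) 1)
    (hy : y ∈ Ico (0 : ℝ) 1) (h : ∀ k, digit β x k = digit β y k) : x = y := by
  have h1 := hasSum_digit hβ hx 0
  have h2 := hasSum_digit hβ hy 0
  simp only [h] at h1
  simpa using h1.unique h2

lemma exists_first_digit_ne (β : ℝ) {x y : ℝ} (h : ∃ k, digit β x k ≠ digit β y k) :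
    ∃ n, (∀ k < n, digit β x k = digit β y k) ∧ digit β x n ≠ digit β y n := by
  classical
  exact ⟨Nat.find h, fun k hk => not_not.1 (Nat.find_min h hk), Nat.find_spec h⟩

/-- The β-expansion is monotone for the lexicographic order, already on convergents. -/
lemma convergent_lt_of_digit_lt {β : ℝ} (hβ : 1 < β) {x y : ℝ} (hy : y ∈ Ico (0 : ℝ) 1)
    {i : ℕ} (h : ∀ k < i, digit β x k = digit β y k) (hi : digit β y i < digit β x i) (N : ℕ) :
    convergent β y N < convergent β x (i + 1) := by
  have h1 := convergent_le hβ hy N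
  have h2 := sub_convergent hβ y (i + 1)
  have hpos : 0 < β ^ (i + 1) := by positivity
  have h3 : (T β)^[i + 1] y / β ^ (i + 1) < 1 / β ^ (i + 1) := by
    have := (iterate_T_mem_Ico β hy (i + 1)).2
    gcongr
  have h4 : (digit β y i : ℝ) + 1 ≤ digit β x i := by exact_mod_cast hi
  have h5 : ((digit β y i : ℝ) + 1) / β ^ (i + 1) ≤ digit β x i / β ^ (i + 1) := by gcongr
  rw [add_div] at h5
  rw [convergent_succ] at h2 ⊢
  rw [convergent_congr β h]
  linarith

/-! ### Counting convergents -/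

/-- The set of convergents of order `n` of points of `[0,1)`. -/
def convergents (β : ℝ) (n : ℕ) : Set ℝ := (fun x => convergent β x n) '' Ico 0 1

/-- A convergent that is new at order `n + 1` ends in a nonzero digit. If the expansions first
differ before that digit, the smaller convergent already lies below the prefix of the larger one,
and the last digit supplies the gap. -/
lemma le_sub_of_mem_convergents {β : ℝ} (hβ : 1 < β) {n : ℕ} {p q : ℝ}
    (hp : p ∈ convergents β (n + 1)) (hq : q ∈ convergents β (n + 1) \ convergents β n)
    (hpq : p < q) : 1 / β ^ (n + 1) ≤ q - p := by
  obtain ⟨y, hy, rfl⟩ := hp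
  obtain ⟨⟨x, hx, rfl⟩, hqn⟩ := hq
  simp only at hpq hqn ⊢
  have hd : 1 ≤ digit β x n := by
    by_contra hlt
    have h0 : digit β x n = 0 := le_antisymm (by omega) (digit_nonneg hβ hx n)
    exact hqn ⟨x, hx, by simp [convergent_succ, h0]⟩
  have hpos : 0 < β ^ (n + 1) := by positivity
  have hne : ∃ k, digit β x k ≠ digit β y k := by
    by_contra! hall
    exact hpq.ne (convergent_congr β fun k _ => (hall k).symm)
  obtain ⟨i, hi, hne⟩ := exists_first_digit_ne β hne
  have hin : i ≤ n := by
    by_contra! hlt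
    exact hpq.ne (convergent_congr β fun k hk => (hi k (by omega)).symm)
  rcases lt_or_gt_of_ne hne with hlt | hlt
  · have h1 := convergent_lt_of_digit_lt hβ hx (fun k hk => (hi k hk).symm) hlt (n + 1)
    have h2 := convergent_mono hβ hy (show i + 1 ≤ n + 1 by omega)
    linarith
  · rcases hin.eq_or_lt with rfl | hin
    · have h4 : (1 : ℝ) ≤ digit β x i - digit β y i := by
        have : digit β y i + 1 ≤ digit β x i := hlt
        have : (digit β y i : ℝ) + 1 ≤ digit β x i := by exact_mod_cast this
        linarith
      rw [convergent_succ, convergent_succ, convergent_congr β hi, add_sub_add_left_eq_sub,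
        ← sub_div]
      gcongr
    · have h1 := convergent_lt_of_digit_lt hβ hy hi hlt (n + 1)
      have h2 := convergent_mono hβ hx (show i + 1 ≤ n by omega)
      have h3 : 1 / β ^ (n + 1) ≤ digit β x n / β ^ (n + 1) := by
        have : (1 : ℝ) ≤ digit β x n := by exact_mod_cast hd
        gcongr
      rw [convergent_succ β x n]
      linarith

lemma finite_and_ncard_le_of_separated {S : Set ℝ} {s : ℝ} (hs : 0 < s) (hS : S ⊆ Ico 0 1)
    (hsep : ∀ p ∈ S, ∀ q ∈ S, p < q → s ≤ q - p) :
    S.Finite ∧ (S.ncard : ℝ) ≤ 1 / s + 1 := by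
  have hinj : InjOn (fun a : ℝ => ⌊a / s⌋₊) S := by
    have key : ∀ p ∈ S, ∀ q ∈ S, p < q → ⌊p / s⌋₊ ≠ ⌊q / s⌋₊ := fun p hp q hq hpq heq => by
      have h1 : q / s < ⌊p / s⌋₊ + 1 := by rw [heq]; exact Nat.lt_floor_add_one _
      have h2 : (⌊p / s⌋₊ : ℝ) ≤ p / s := Nat.floor_le (div_nonneg (hS hp).1 hs.le)
      have h3 : 1 ≤ (q - p) / s := (one_le_div hs).2 (hsep p hp q hq hpq)
      rw [sub_div] at h3
      linarith
    intro p hp q hq heq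
    rcases lt_trichotomy p q with h | h | h
    · exact absurd heq (key p hp q hq h)
    · exact h
    · exact absurd heq.symm (key q hq p hp h)
  have hmaps : MapsTo (fun a : ℝ => ⌊a / s⌋₊) S (Finset.range (⌊1 / s⌋₊ + 1) : Set ℕ) := by
    intro a ha
    simp only [Finset.coe_range, mem_Iio, Nat.lt_succ_iff]
    have := (hS ha).2.le
    gcongr
  refine ⟨Set.Finite.of_injOn hmaps hinj (Finset.finite_toSet _), ?_⟩
  have h1 := Set.ncard_le_ncard_of_injOn _ hmaps hinj (Finset.finite_toSet _)
  rw [Set.ncard_coe_finset, Finset.card_range] at h1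
  have h2 : (⌊1 / s⌋₊ : ℝ) ≤ 1 / s := Nat.floor_le (by positivity)
  have h3 : (S.ncard : ℝ) ≤ ⌊1 / s⌋₊ + 1 := by exact_mod_cast h1
  linarith

/-- Separation allows at most `β^(n+1) + 1 ≤ 2 β^(n+1)` new convergents at order `n + 1`; the
constant `K` solves `K + 2 β = K β`. -/
lemma convergents_finite_and_ncard_le {β : ℝ} (hβ : 1 < β) (n : ℕ) :
    (convergents β n).Finite ∧ ((convergents β n).ncard : ℝ) ≤ 2 * β / (β - 1) * β ^ n := by
  have hβ1 : 0 < β - 1 := by linarith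
  induction n with
  | zero =>
    have h : convergents β 0 ⊆ {0} := by
      rintro _ ⟨x, -, rfl⟩
      simp [convergent]
    refine ⟨(finite_singleton 0).subset h, ?_⟩
    have h1 := Set.ncard_le_ncard h (finite_singleton 0)
    rw [ncard_singleton] at h1
    have h2 : ((convergents β 0).ncard : ℝ) ≤ 1 := by exact_mod_cast h1
    refine h2.trans ?_
    rw [pow_zero, mul_one, one_le_div hβ1]
    linarith
  | succ n ih =>
    obtain ⟨hfin, hcard⟩ := ih
    have hpos : 0 < β ^ (n + 1) := by positivity
    obtain ⟨hf, hc⟩ := finite_and_ncard_le_of_separated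
      (S := convergents β (n + 1) \ convergents β n) (s := 1 / β ^ (n + 1)) (by positivity)
      (by
        rintro _ ⟨⟨x, hx, rfl⟩, -⟩
        exact ⟨convergent_nonneg hβ hx _, (convergent_le hβ hx _).trans_lt hx.2⟩)
      (fun p hp q hq hpq => le_sub_of_mem_convergents hβ hp.1 hq hpq)
    have hsub : convergents β (n + 1)
        ⊆ convergents β n ∪ (convergents β (n + 1) \ convergents β n) := by
      rw [union_sdiff_self]; exact subset_union_right
    refine ⟨(hfin.union hf).subset hsub, ?_⟩
    have h1 : ((convergents β (n + 1)).ncard : ℝ)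
        ≤ (convergents β n).ncard + (convergents β (n + 1) \ convergents β n).ncard := by
      exact_mod_cast (Set.ncard_le_ncard hsub (hfin.union hf)).trans (Set.ncard_union_le _ _)
    rw [one_div_one_div] at hc
    have h2 : 1 ≤ β ^ (n + 1) := one_le_pow₀ hβ.le
    calc ((convergents β (n + 1)).ncard : ℝ)
        ≤ 2 * β / (β - 1) * β ^ n + 2 * β ^ (n + 1) := by linarith
      _ = 2 * β / (β - 1) * β ^ (n + 1) := by field_simp; ring

/-! ### Level sets in terms of remainders -/

lemma one_div_mul_elogb_lt {β : ℝ} (hβ : 1 < β) {r a : ℝ} {n : ℕ} (hn : 0 < n) :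
    ((1 / (n : ℝ) : ℝ) : EReal) * elogb β r < ((-a : ℝ) : EReal) ↔ r < β ^ (-a * n) := by
  have hn' : (0 : ℝ) < n := by exact_mod_cast hn
  have hinv : (0 : ℝ) < 1 / n := by positivity
  unfold elogb
  split_ifs with hr
  · rw [← EReal.coe_mul, EReal.coe_lt_coe_iff, one_div_mul_eq_div, div_lt_iff₀ hn',
      Real.logb_lt_iff_lt_rpow hβ hr]
  -- For `r ≤ 0` both sides hold; `n > 0` matters because `0 * ⊥ = 0`.
  · rw [EReal.coe_mul_bot_of_pos hinv]
    refine ⟨fun _ => ?_, fun _ => EReal.bot_lt_coe _⟩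
    exact (not_lt.1 hr).trans_lt (Real.rpow_pos_of_pos (by linarith) _)

lemma mem_levelSet_of {β : ℝ} (hβ : 1 < β) {α y : ℝ} (hα : 0 < α) (hy : y ∈ Ico (0 : ℝ) 1)
    (hup : ∀ a, 0 < a → a < α → ∃ᶠ n : ℕ in atTop, y - convergent β y n < β ^ (-a * n))
    (hlow : ∀ a, α < a → ∀ᶠ n : ℕ in atTop, β ^ (-a * n) ≤ y - convergent β y n) :
    y ∈ levelSet β α := by
  refine ⟨hy, le_antisymm ?_ ?_⟩
  · refine EReal.le_of_forall_lt_iff_le.1 fun b hb => ?_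
    have hb' : -α < b := by exact_mod_cast hb
    -- The minimum with `0` makes `-c` positive, as `hup` demands.
    obtain ⟨c, hc1, hc2⟩ := exists_between (lt_min hb' (neg_lt_zero.2 hα))
    have hfr := ((hup (-c) (by linarith [hc2.trans_le (min_le_right b 0)])
      (by linarith)).and_eventually (eventually_gt_atTop 0))
    refine liminf_le_of_frequently_le (hfr.mono ?_)
    rintro n ⟨h1, h2⟩
    have := (one_div_mul_elogb_lt hβ h2).2 h1
    rw [neg_neg] at this
    exact this.le.trans (by exact_mod_cast (hc2.trans_le (min_le_left b 0)).le)
  · refine EReal.ge_of_forall_gt_iff_ge.1 fun b hb => ?_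
    have hb' : b < -α := by exact_mod_cast hb
    refine le_liminf_of_le (by isBoundedDefault) ?_
    filter_upwards [hlow (-b) (by linarith), eventually_gt_atTop 0] with n h1 h2
    have := (one_div_mul_elogb_lt hβ (a := -b) (r := y - convergent β y n) h2).not.2 (not_lt.2 h1)
    rw [neg_neg] at this
    exact not_lt.1 this

lemma frequently_of_mem_levelSet {β : ℝ} (hβ : 1 < β) {α y : ℝ} (hy : y ∈ levelSet β α) {a : ℝ}
    (ha : a < α) : ∃ᶠ n : ℕ in atTop, y - convergent β y n < β ^ (-a * n) := by
  have h : ∃ᶠ n : ℕ in atTop, ((1 / (n : ℝ) : ℝ) : EReal) * elogb β (y - convergent β y n)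
      < ((-a : ℝ) : EReal) := by
    refine frequently_lt_of_liminf_lt (by isBoundedDefault) ?_
    rw [hy.2]
    exact_mod_cast neg_lt_neg ha
  refine (h.and_eventually (eventually_gt_atTop 0)).mono ?_
  rintro n ⟨h1, h2⟩
  exact (one_div_mul_elogb_lt hβ h2).1 h1

lemma sub_convergent_lt {β : ℝ} (hβ : 1 < β) {x : ℝ} (hx : x ∈ Ico (0 : ℝ) 1) (n : ℕ) :
    x - convergent β x n < β ^ (-1 * (n : ℝ)) := by
  rw [sub_convergent hβ, neg_one_mul, Real.rpow_neg (by linarith), Real.rpow_natCast, ← one_div]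
  have := (iterate_T_mem_Ico β hx n).2
  gcongr

lemma levelSet_eq_empty {β : ℝ} (hβ : 1 < β) {α : ℝ} (hα : α < 1) : levelSet β α = ∅ := by
  refine eq_empty_of_forall_notMem fun x hx => ?_
  have h1 : ∀ᶠ n : ℕ in atTop, ((1 / (n : ℝ) : ℝ) : EReal) * elogb β (x - convergent β x n)
      < ((-1 : ℝ) : EReal) := by
    filter_upwards [eventually_gt_atTop 0] with n hn
    exact (one_div_mul_elogb_lt hβ hn).2 (sub_convergent_lt hβ hx.1 n)
  have h2 := liminf_le_of_frequently_le (h1.frequently.mono fun n hn => hn.le)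
  rw [hx.2] at h2
  have : -α ≤ -1 := by exact_mod_cast h2
  linarith

/-! ### Coverings by short intervals at convergents -/

lemma tsum_convergents_const_le {β : ℝ} (hβ : 1 < β) (n : ℕ) {c : ℝ} (hc : 0 ≤ c) :
    ∑' _ : convergents β n, ENNReal.ofReal c
      ≤ ENNReal.ofReal (2 * β / (β - 1) * β ^ n * c) := by
  obtain ⟨hfin, hcard⟩ := convergents_finite_and_ncard_le hβ n
  rw [ENNReal.tsum_const]
  have h : ((ENat.card (convergents β n) : ℕ∞) : ℝ≥0∞) = ((convergents β n).ncard : ℝ≥0∞) := by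
    rw [← Set.encard, ← hfin.cast_ncard_eq]
    rfl
  rw [h, ← ENNReal.ofReal_natCast, ← ENNReal.ofReal_mul (by positivity)]
  exact ENNReal.ofReal_le_ofReal (by gcongr)

lemma dimH_levelSet_le {β : ℝ} (hβ : 1 < β) {α : ℝ} (hα : 1 ≤ α) :
    dimH (levelSet β α) ≤ ENNReal.ofReal (1 / α) := by
  have hβ0 : 0 < β := by linarith
  refine le_of_forall_gt fun b hb => ?_
  obtain ⟨d, hd1, hd2⟩ := ENNReal.lt_iff_exists_nnreal_btwn.1 hb
  refine lt_of_le_of_lt ?_ hd2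
  have hdα : 1 / α < d := by
    rwa [← ENNReal.ofReal_coe_nnreal, ENNReal.ofReal_lt_ofReal_iff_of_nonneg (by positivity)]
      at hd1
  have hd0 : (0 : ℝ) < d := lt_trans (by positivity) hdα
  obtain ⟨a, ha1, ha2⟩ := exists_between (show 1 / (d : ℝ) < α by
    rw [div_lt_iff₀ hd0]
    rwa [div_lt_iff₀ (by linarith), mul_comm] at hdα)
  have ha0 : 0 < a := lt_trans (by positivity) ha1
  have had : 1 < a * d := (div_lt_iff₀ hd0).1 ha1
  set ρ : ℝ := β ^ (1 - a * d) with hρ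
  have hρ0 : 0 < ρ := Real.rpow_pos_of_pos hβ0 _
  have hρ1 : ρ < 1 := Real.rpow_lt_one_of_one_lt_of_neg hβ (by linarith)
  set K := 2 * β / (β - 1) with hK
  have hK0 : 0 < K := div_pos (by linarith) (by linarith)
  -- Only orders at least `n` are used, so the diameters tend to `0` and the sums are tails of a
  -- geometric series.
  let t : ∀ n : ℕ, (Σ k : ℕ, convergents β (k + n)) → Set ℝ := fun n i =>
    Icc (i.2 : ℝ) (i.2 + β ^ (-a * ((i.1 + n : ℕ) : ℝ)))
  have hdiam : ∀ n i, Metric.ediam (t n i)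
      = ENNReal.ofReal (β ^ (-a * ((i.1 + n : ℕ) : ℝ))) := fun n i => by
    simp only [t, Real.ediam_Icc, add_sub_cancel_left]
  have : ∀ k, Countable (convergents β k) := fun k =>
    (convergents_finite_and_ncard_le hβ k).1.countable.to_subtype
  have hzero : μH[(d : ℝ)] (levelSet β α) ≤ 0 := by
    have hr : Tendsto (fun n : ℕ => ENNReal.ofReal (β ^ (-a * (n : ℝ)))) atTop (𝓝 0) := by
      rw [← ENNReal.ofReal_zero]
      refine (ENNReal.continuous_ofReal.tendsto 0).comp ?_
      have : ∀ n : ℕ, β ^ (-a * (n : ℝ)) = (β ^ (-a)) ^ n := fun n => by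
        rw [Real.rpow_mul hβ0.le, Real.rpow_natCast]
      simp only [this]
      exact tendsto_pow_atTop_nhds_zero_of_lt_one (Real.rpow_nonneg hβ0.le _)
        (Real.rpow_lt_one_of_one_lt_of_neg hβ (by linarith))
    refine (Measure.hausdorffMeasure_le_liminf_tsum (d : ℝ) (levelSet β α) _ hr t ?_ ?_).trans ?_
    · refine Eventually.of_forall fun n i => ?_
      rw [hdiam]
      refine ENNReal.ofReal_le_ofReal (Real.rpow_le_rpow_of_exponent_le hβ.le ?_)
      have : (n : ℝ) ≤ ((i.1 + n : ℕ) : ℝ) := by exact_mod_cast Nat.le_add_left _ _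
      nlinarith
    · refine Eventually.of_forall fun n x hx => ?_
      obtain ⟨m, hm, hlt⟩ := frequently_atTop.1 (frequently_of_mem_levelSet hβ hx ha2) n
      obtain ⟨k, rfl⟩ := Nat.exists_eq_add_of_le' hm
      refine mem_iUnion.2 ⟨⟨k, ⟨convergent β x (k + n), x, hx.1, rfl⟩⟩, ?_, ?_⟩
      · exact convergent_le hβ hx.1 _
      · simp only
        linarith
    · have hsum : ∀ n, ∑' i, Metric.ediam (t n i) ^ (d : ℝ)
          ≤ ∑' k, ENNReal.ofReal (K * ρ ^ (k + n)) := fun n => by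
        have hterm : ∀ i : Σ k : ℕ, convergents β (k + n), Metric.ediam (t n i) ^ (d : ℝ)
            = ENNReal.ofReal (β ^ (-a * d * ((i.1 + n : ℕ) : ℝ))) := fun i => by
          rw [hdiam, ENNReal.ofReal_rpow_of_pos (Real.rpow_pos_of_pos hβ0 _),
            ← Real.rpow_mul hβ0.le]
          congr 2
          ring
        simp only [hterm]
        rw [ENNReal.tsum_sigma
          (fun k (_ : convergents β (k + n)) => ENNReal.ofReal (β ^ (-a * d * ((k + n : ℕ) : ℝ))))]
        refine ENNReal.tsum_le_tsum fun k => ?_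
        refine (tsum_convergents_const_le hβ (k + n) (Real.rpow_nonneg hβ0.le _)).trans_eq ?_
        congr 1
        rw [mul_assoc, hρ, ← Real.rpow_natCast β (k + n), ← Real.rpow_add hβ0,
          ← Real.rpow_natCast (β ^ (1 - a * d)), ← Real.rpow_mul hβ0.le]
        congr 2
        ring
      have hlim := ENNReal.tendsto_sum_nat_add (fun k => ENNReal.ofReal (K * ρ ^ k)) (by
        rw [← ENNReal.ofReal_tsum_of_nonneg (fun k => by positivity)
          ((summable_geometric_of_lt_one hρ0.le hρ1).mul_left K)]
        exact ENNReal.ofReal_ne_top)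
      rw [← hlim.liminf_eq]
      exact liminf_le_liminf (Eventually.of_forall hsum)
  refine dimH_le_of_hausdorffMeasure_ne_top ?_
  rw [nonpos_iff_eq_zero.1 hzero]
  exact ENNReal.zero_ne_top

/-! ### Slowly recurrent points have full dimension -/

lemma volume_iterate_T_lt_le {β : ℝ} (hβ : 1 < β) (n : ℕ) {δ : ℝ} (hδ : 0 ≤ δ) :
    volume {x ∈ Ico (0 : ℝ) 1 | (T β)^[n] x < δ} ≤ ENNReal.ofReal (2 * β / (β - 1) * δ) := by
  have hpos : 0 < β ^ n := by positivity
  have hsub : {x ∈ Ico (0 : ℝ) 1 | (T β)^[n] x < δ}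
      ⊆ ⋃ a ∈ convergents β n, Icc a (a + δ / β ^ n) := by
    rintro x ⟨hx, hlt⟩
    refine mem_biUnion ⟨x, hx, rfl⟩ ⟨convergent_le hβ hx n, ?_⟩
    have h := sub_convergent hβ x n
    have : (T β)^[n] x / β ^ n ≤ δ / β ^ n := by gcongr
    simp only
    linarith
  refine (measure_mono hsub).trans
    ((measure_biUnion_le _ (convergents_finite_and_ncard_le hβ n).1.countable _).trans ?_)
  simp only [Real.volume_Icc, add_sub_cancel_left]
  refine (tsum_convergents_const_le hβ n (by positivity)).trans_eq ?_
  congr 1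
  field_simp

/-- Points whose orbit approaches `0` at most quadratically. -/
def slowSet (β c : ℝ) : Set ℝ := {x ∈ Ico (0 : ℝ) 1 | ∀ n : ℕ, c / ((n : ℝ) + 1) ^ 2 ≤ (T β)^[n] x}

lemma exists_one_le_dimH_slowSet {β : ℝ} (hβ : 1 < β) :
    ∃ c > 0, 1 ≤ dimH (slowSet β c) := by
  set K := 2 * β / (β - 1) with hK
  have hK0 : 0 < K := div_pos (by linarith) (by linarith)
  have hsm : Summable fun n : ℕ => 1 / ((n : ℝ) + 1) ^ 2 := by
    have := (summable_nat_add_iff 1).2 (Real.summable_one_div_nat_pow.2 one_lt_two)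
    simpa using this
  set S := ∑' n : ℕ, 1 / ((n : ℝ) + 1) ^ 2 with hS
  have hS0 : 0 ≤ S := tsum_nonneg fun n => by positivity
  -- With this `c` the exceptional sets have total measure at most `S / (S + 1) < 1`.
  refine ⟨1 / (K * (S + 1)), by positivity, ?_⟩
  set c := 1 / (K * (S + 1)) with hc
  have hc0 : 0 < c := by positivity
  have hKc : K * c * S < 1 := by
    have : K * c * S = S / (S + 1) := by rw [hc]; field_simp
    rw [this, div_lt_one (by linarith)]
    linarith
  have hcov : Ico (0 : ℝ) 1 ⊆ slowSet β c ∪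
      ⋃ n : ℕ, {x ∈ Ico (0 : ℝ) 1 | (T β)^[n] x < c / ((n : ℝ) + 1) ^ 2} := by
    intro x hx
    by_cases h : x ∈ slowSet β c
    · exact Or.inl h
    · right
      simp only [slowSet, mem_ofPred_eq, not_and, not_forall, not_le] at h
      obtain ⟨n, hn⟩ := h hx
      exact mem_iUnion.2 ⟨n, hx, hn⟩
  have hbad : volume (⋃ n : ℕ, {x ∈ Ico (0 : ℝ) 1 | (T β)^[n] x < c / ((n : ℝ) + 1) ^ 2})
      ≤ ENNReal.ofReal (K * c * S) := by
    refine (measure_iUnion_le _).trans ?_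
    rw [hS, ← tsum_mul_left, ENNReal.ofReal_tsum_of_nonneg (fun n => by positivity)
      (hsm.mul_left _)]
    refine ENNReal.tsum_le_tsum fun n => ?_
    refine (volume_iterate_T_lt_le hβ n (by positivity)).trans_eq ?_
    congr 1
    ring
  have hne : volume (slowSet β c) ≠ 0 := fun h0 => by
    have h1 := (measure_mono hcov).trans (measure_union_le (μ := volume) _ _)
    rw [h0, zero_add, Real.volume_Ico] at h1
    have h2 := h1.trans hbad
    rw [ENNReal.ofReal_le_ofReal_iff (by positivity)] at h2
    linarith
  rw [← hausdorffMeasure_real] at hne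
  have := le_dimH_of_hausdorffMeasure_ne_zero (d := 1) (s := slowSet β c) (by simpa using hne)
  simpa using this

lemma exists_le_iterate_T_of_mem_slowSet {β c : ℝ} (hβ : 1 < β) (hc : 0 < c) {η : ℝ}
    (hη : 0 < η) :
    ∃ C > 0, ∀ x ∈ slowSet β c, ∀ n : ℕ, C * β ^ (-η * n) ≤ (T β)^[n] x := by
  have hβ0 : 0 < β := by linarith
  have hr0 : 0 < β ^ (-η) := Real.rpow_pos_of_pos hβ0 _
  have hr1 : β ^ (-η) < 1 := Real.rpow_lt_one_of_one_lt_of_neg hβ (by linarith)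
  have hlim := tendsto_pow_const_mul_const_pow_of_abs_lt_one 2
    (show |β ^ (-η)| < 1 by rwa [abs_of_pos hr0])
  obtain ⟨M, hM⟩ := hlim.bddAbove_range
  have hM' : ∀ n : ℕ, (n : ℝ) ^ 2 * (β ^ (-η)) ^ n ≤ M := fun n => hM ⟨n, rfl⟩
  have hM0 : 0 < M := lt_of_lt_of_le (by simpa using hr0) (hM' 1)
  refine ⟨c * β ^ (-η) / M, by positivity, fun x hx n => le_trans ?_ (hx.2 n)⟩
  have h := hM' (n + 1)
  rw [Real.rpow_mul hβ0.le, Real.rpow_natCast, le_div_iff₀ (by positivity)]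
  calc c * β ^ (-η) / M * (β ^ (-η)) ^ n * ((n : ℝ) + 1) ^ 2
      = c / M * (((n + 1 : ℕ) : ℝ) ^ 2 * (β ^ (-η)) ^ (n + 1)) := by push_cast; ring
    _ ≤ c / M * M := by gcongr
    _ = c := by field_simp

/-! ### Inserting zeros into a β-expansion -/

/-- The tail from index `n` of the series obtained from the β-expansion of `x` by moving the digit
with index `k` to the index `p k`. -/
noncomputable def spreadTail (β : ℝ) (p : ℕ → ℕ) (x : ℝ) (n : ℕ) : ℝ :=
  ∑' k, (digit β x (n + k) : ℝ) / β ^ (p (n + k) + 1)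

lemma add_le_of_strictMono {p : ℕ → ℕ} (hp : StrictMono p) (n k : ℕ) : p n + k ≤ p (n + k) := by
  induction k with
  | zero => rfl
  | succ k ih => have := hp (show n + k < n + (k + 1) by omega); omega

section

variable {β : ℝ} {p : ℕ → ℕ} {x : ℝ}

lemma spread_term_nonneg (hβ : 1 < β) (hx : x ∈ Ico (0 : ℝ) 1) (p : ℕ → ℕ) (k : ℕ) :
    0 ≤ (digit β x k : ℝ) / β ^ (p k + 1) := by
  have : (0 : ℝ) ≤ digit β x k := by exact_mod_cast digit_nonneg hβ hx k
  positivity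

/-- Gaps between digits never shrink, so from index `n` on every digit moves right by at least `p n
- n`. Hence the new tail is below `β^(-p n)`, which is what makes the spread digits admissible. -/
lemma spread_term_le (hβ : 1 < β) (hp : StrictMono p) (hx : x ∈ Ico (0 : ℝ) 1) (n k : ℕ) :
    (digit β x (n + k) : ℝ) / β ^ (p (n + k) + 1)
      ≤ β ^ n / β ^ p n * ((digit β x (n + k) : ℝ) / β ^ (n + k + 1)) := by
  have h0 : (0 : ℝ) ≤ digit β x (n + k) := by exact_mod_cast digit_nonneg hβ hx (n + k)
  have h1 : β ^ (p n + k) ≤ β ^ p (n + k) := pow_le_pow_right₀ hβ.le (add_le_of_strictMono hp n k)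
  calc (digit β x (n + k) : ℝ) / β ^ (p (n + k) + 1)
      ≤ digit β x (n + k) / (β ^ (p n + k) * β) := by
        rw [pow_succ]
        gcongr
    _ = _ := by
        rw [pow_add, pow_succ, pow_add]
        field_simp

lemma summable_spread (hβ : 1 < β) (hp : StrictMono p) (hx : x ∈ Ico (0 : ℝ) 1) (n : ℕ) :
    Summable fun k => (digit β x (n + k) : ℝ) / β ^ (p (n + k) + 1) :=
  Summable.of_nonneg_of_le (fun k => spread_term_nonneg hβ hx p (n + k))
    (spread_term_le hβ hp hx n) ((hasSum_digit hβ hx n).summable.mul_left _)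

lemma spreadTail_nonneg (hβ : 1 < β) (hx : x ∈ Ico (0 : ℝ) 1) (n : ℕ) :
    0 ≤ spreadTail β p x n :=
  tsum_nonneg fun k => spread_term_nonneg hβ hx p (n + k)

lemma spreadTail_le (hβ : 1 < β) (hp : StrictMono p) (hx : x ∈ Ico (0 : ℝ) 1) (n : ℕ) :
    spreadTail β p x n ≤ (T β)^[n] x / β ^ p n := by
  have h := hasSum_digit hβ hx n
  refine ((summable_spread hβ hp hx n).tsum_le_tsum (spread_term_le hβ hp hx n)
    (h.summable.mul_left _)).trans_eq ?_
  rw [tsum_mul_left, h.tsum_eq]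
  field_simp

lemma spreadTail_lt (hβ : 1 < β) (hp : StrictMono p) (hx : x ∈ Ico (0 : ℝ) 1) (n : ℕ) :
    spreadTail β p x n < 1 / β ^ p n := by
  refine (spreadTail_le hβ hp hx n).trans_lt ?_
  have := (iterate_T_mem_Ico β hx n).2
  gcongr

lemma spreadTail_eq_add (hβ : 1 < β) (hp : StrictMono p) (hx : x ∈ Ico (0 : ℝ) 1) (n : ℕ) :
    spreadTail β p x n = digit β x n / β ^ (p n + 1) + spreadTail β p x (n + 1) := by
  rw [spreadTail, (summable_spread hβ hp hx n).tsum_eq_zero_add, spreadTail]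
  simp only [add_zero, add_assoc, add_comm 1]

lemma div_le_spreadTail (hβ : 1 < β) (hp : StrictMono p) (hx : x ∈ Ico (0 : ℝ) 1) {n j : ℕ}
    (hj : n ≤ j) : (digit β x j : ℝ) / β ^ (p j + 1) ≤ spreadTail β p x n := by
  obtain ⟨k, rfl⟩ := Nat.exists_eq_add_of_le hj
  exact (summable_spread hβ hp hx n).le_tsum k fun i _ => spread_term_nonneg hβ hx p (n + i)

lemma spreadTail_zero_mem_Ico (hβ : 1 < β) (hp : StrictMono p) (hx : x ∈ Ico (0 : ℝ) 1) :
    spreadTail β p x 0 ∈ Ico (0 : ℝ) 1 := by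
  refine ⟨spreadTail_nonneg hβ hx 0, (spreadTail_lt hβ hp hx 0).trans_le ?_⟩
  exact (div_le_one (by positivity)).2 (one_le_pow₀ hβ.le)

/-- Moving the digits of a β-expansion apart gives a β-expansion again; its remainders are the
tails of the new series. -/
lemma iterate_T_spread (hβ : 1 < β) (hp : StrictMono p) (hx : x ∈ Ico (0 : ℝ) 1) (m : ℕ) :
    ∀ n, m ≤ p n → (∀ k < n, p k < m) →
      (T β)^[m] (spreadTail β p x 0) = β ^ m * spreadTail β p x n := by
  have hβ0 : 0 < β := by linarith
  induction m with
  | zero =>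
    intro n _ h
    have : n = 0 := Nat.eq_zero_of_not_pos fun hn => absurd (h 0 hn) (Nat.not_lt_zero _)
    simp [this]
  | succ m ih =>
    intro n hn h
    have hlt : β ^ (m + 1) * spreadTail β p x n < 1 := by
      refine (mul_lt_mul_of_pos_left (spreadTail_lt hβ hp hx n) (by positivity)).trans_le ?_
      rw [mul_one_div, div_le_one (by positivity)]
      exact pow_le_pow_right₀ hβ.le hn
    have hnn : 0 ≤ β ^ (m + 1) * spreadTail β p x n :=
      mul_nonneg (by positivity) (spreadTail_nonneg hβ hx n)
    rw [Function.iterate_succ_apply']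
    -- Either position `m` holds an inserted zero and the floor vanishes, or `m = p k` with `n = k +
    -- 1` and the floor removes digit `k`.
    by_cases hm : ∀ k < n, p k < m
    · rw [ih n (by omega) hm, T, ← mul_assoc, ← pow_succ',
        Int.floor_eq_zero_iff.2 ⟨hnn, hlt⟩]
      simp
    · push Not at hm
      obtain ⟨k, hkn, hk⟩ := hm
      have hpk : p k = m := le_antisymm (Nat.lt_succ_iff.1 (h k hkn)) hk
      obtain rfl : n = k + 1 := by
        by_contra hne
        have h1 := h (k + 1) (by omega)
        have h2 := hp (Nat.lt_succ_self k)
        simp only [Nat.succ_eq_add_one] at h2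
        omega
      rw [ih k hpk.ge fun i hi => hpk ▸ hp hi, T, ← mul_assoc, ← pow_succ',
        spreadTail_eq_add hβ hp hx k, mul_add, hpk,
        mul_div_cancel₀ _ (by positivity : β ^ (m + 1) ≠ 0), Int.floor_intCast_add,
        Int.floor_eq_zero_iff.2 ⟨hnn, hlt⟩]
      simp

lemma sub_convergent_spread (hβ : 1 < β) (hp : StrictMono p) (hx : x ∈ Ico (0 : ℝ) 1) {m n : ℕ}
    (hn : m ≤ p n) (h : ∀ k < n, p k < m) :
    spreadTail β p x 0 - convergent β (spreadTail β p x 0) m = spreadTail β p x n := by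
  rw [sub_convergent hβ, iterate_T_spread hβ hp hx m n hn h]
  field_simp

/-- Zero digits leave the remainder unchanged up to the next nonzero digit `j`; a lower bound on
`T^n x` therefore bounds `j`. -/
lemma exists_one_le_digit (hβ : 1 < β) (hx : x ∈ Ico (0 : ℝ) 1) {n : ℕ}
    (h : 0 < (T β)^[n] x) : ∃ j, n ≤ j ∧ 1 ≤ digit β x j ∧ (T β)^[n] x / β ^ n ≤ 1 / β ^ j := by
  classical
  have hex : ∃ k, digit β x (n + k) ≠ 0 := by
    by_contra! hall
    have hs := hasSum_digit hβ hx n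
    simp only [hall, Int.cast_zero, zero_div] at hs
    have h1 := hs.unique hasSum_zero
    have h2 : 0 < (T β)^[n] x / β ^ n := by positivity
    exact h2.ne' h1
  refine ⟨n + Nat.find hex, Nat.le_add_right _ _, ?_, ?_⟩
  · have := digit_nonneg hβ hx (n + Nat.find hex)
    have := Nat.find_spec hex
    omega
  · have hconst : ∀ k ≤ Nat.find hex,
        (T β)^[n] x / β ^ n = (T β)^[n + k] x / β ^ (n + k) := fun k => by
      induction k with
      | zero => simp
      | succ k ih =>
        intro hk
        have h0 : digit β x (n + k) = 0 := not_not.1 (Nat.find_min hex (by omega))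
        have h1 := digit_div_pow hβ x (n + k)
        rw [h0, Int.cast_zero, zero_div] at h1
        rw [ih (by omega), ← add_assoc]
        linarith
    rw [hconst _ le_rfl]
    have := (iterate_T_mem_Ico β hx (n + Nat.find hex)).2.le
    gcongr

/-- The first nonzero digit `j ≥ n` alone bounds the tail from below: slowness keeps `j` within `(1
+ η / α) n` up to a constant, and `p j ≤ α j`. -/
lemma exists_le_spreadTail (hβ : 1 < β) (hp : StrictMono p) {α c η : ℝ} (hα : 0 < α)
    (hpα : ∀ k, (p k : ℝ) ≤ α * k) (hc : 0 < c) (hη : 0 < η) :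
    ∃ C > 0, ∀ x ∈ slowSet β c, ∀ n : ℕ, C * β ^ (-(α + η) * n) ≤ spreadTail β p x n := by
  have hβ0 : 0 < β := by linarith
  obtain ⟨C, hC, h⟩ := exists_le_iterate_T_of_mem_slowSet (c := c) hβ hc
    (show 0 < η / α by positivity)
  refine ⟨C ^ α / β, by positivity, fun x hx n => ?_⟩
  have hT := h x hx n
  have hlow : 0 < C * β ^ (-(η / α) * n) := mul_pos hC (Real.rpow_pos_of_pos hβ0 _)
  obtain ⟨j, hnj, hd, hj⟩ := exists_one_le_digit hβ hx.1 (hlow.trans_le hT)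
  refine le_trans ?_ (div_le_spreadTail hβ hp hx.1 hnj)
  have hd' : (1 : ℝ) ≤ digit β x j := by exact_mod_cast hd
  have h1 : C * β ^ (-(η / α) * n) / β ^ n ≤ 1 / β ^ j := le_trans (by gcongr) hj
  have h2 : C * β ^ (-(1 + η / α) * n) ≤ β ^ (-(j : ℝ)) := by
    calc C * β ^ (-(1 + η / α) * n) = C * β ^ (-(η / α) * n) / β ^ n := by
          rw [mul_div_assoc, ← Real.rpow_natCast β n, ← Real.rpow_sub hβ0]
          congr 2
          ring
      _ ≤ 1 / β ^ j := h1
      _ = β ^ (-(j : ℝ)) := by rw [Real.rpow_neg hβ0.le, Real.rpow_natCast, one_div]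
  have h3 := Real.rpow_le_rpow (mul_pos hC (Real.rpow_pos_of_pos hβ0 _)).le h2 hα.le
  rw [Real.mul_rpow hC.le (Real.rpow_nonneg hβ0.le _), ← Real.rpow_mul hβ0.le,
    ← Real.rpow_mul hβ0.le] at h3
  have h4 : β ^ (-(j : ℝ) * α) ≤ 1 / β ^ p j := by
    rw [one_div, ← Real.rpow_natCast β (p j), ← Real.rpow_neg hβ0.le]
    refine Real.rpow_le_rpow_of_exponent_le hβ.le ?_
    have := hpα j
    nlinarith
  calc C ^ α / β * β ^ (-(α + η) * n) = C ^ α * β ^ (-(1 + η / α) * n * α) / β := by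
        rw [div_mul_eq_mul_div]
        congr 3
        field_simp
    _ ≤ (1 / β ^ p j) / β := by gcongr; exact h3.trans h4
    _ = 1 / β ^ (p j + 1) := by rw [pow_succ]; field_simp
    _ ≤ digit β x j / β ^ (p j + 1) := by gcongr

lemma spreadTail_zero_sub_of_digit_eq (hβ : 1 < β) (hp : StrictMono p) {y : ℝ}
    (hx : x ∈ Ico (0 : ℝ) 1) (hy : y ∈ Ico (0 : ℝ) 1) {n : ℕ}
    (h : ∀ k < n, digit β x k = digit β y k) :
    spreadTail β p x 0 - spreadTail β p y 0 = spreadTail β p x n - spreadTail β p y n := by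
  induction n with
  | zero => rfl
  | succ n ih =>
    rw [ih fun k hk => h k (by omega), spreadTail_eq_add hβ hp hx n, spreadTail_eq_add hβ hp hy n,
      h n (by omega)]
    ring

/-- One unit of digit `n` absorbs the whole later tail of `y`, leaving that of `x`. -/
lemma spreadTail_succ_le_sub (hβ : 1 < β) (hp : StrictMono p) {y : ℝ}
    (hx : x ∈ Ico (0 : ℝ) 1) (hy : y ∈ Ico (0 : ℝ) 1) {n : ℕ}
    (h : ∀ k < n, digit β x k = digit β y k) (hn : digit β y n < digit β x n) :
    spreadTail β p x (n + 1) ≤ spreadTail β p x 0 - spreadTail β p y 0 := by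
  rw [spreadTail_zero_sub_of_digit_eq hβ hp hx hy h, spreadTail_eq_add hβ hp hx n,
    spreadTail_eq_add hβ hp hy n]
  have h1 : spreadTail β p y (n + 1) ≤ 1 / β ^ (p n + 1) := by
    refine (spreadTail_lt hβ hp hy (n + 1)).le.trans ?_
    have : β ^ (p n + 1) ≤ β ^ p (n + 1) := pow_le_pow_right₀ hβ.le (hp (Nat.lt_succ_self n))
    gcongr
  have h4 : (digit β y n : ℝ) + 1 ≤ digit β x n := by exact_mod_cast hn
  have h5 : ((digit β y n : ℝ) + 1) / β ^ (p n + 1) ≤ digit β x n / β ^ (p n + 1) := by gcongr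
  rw [add_div] at h5
  linarith

lemma exists_dist_le_dist_spread_rpow (hβ : 1 < β) (hp : StrictMono p) {α c η : ℝ} (hα : 0 < α)
    (hpα : ∀ k, (p k : ℝ) ≤ α * k) (hc : 0 < c) (hη : 0 < η) :
    ∃ C > 0, ∀ x ∈ slowSet β c, ∀ y ∈ slowSet β c,
      dist x y ≤ C * dist (spreadTail β p x 0) (spreadTail β p y 0) ^ (1 / (α + η)) := by
  have hβ0 : 0 < β := by linarith
  have hs : 0 < α + η := by positivity
  obtain ⟨C, hC, h⟩ := exists_le_spreadTail hβ hp hα hpα hc hη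
  -- The factor `β` pays for comparing `dist x y ≤ β^(-n)` with a tail at index `n + 1`.
  set D := β * (1 / C) ^ (1 / (α + η)) with hD
  have hD0 : 0 < D := by positivity
  have key : ∀ x ∈ slowSet β c, ∀ y ∈ slowSet β c, ∀ n,
      (∀ k < n, digit β x k = digit β y k) → digit β y n < digit β x n →
      dist x y ≤ D * dist (spreadTail β p x 0) (spreadTail β p y 0) ^ (1 / (α + η)) := by
    intro x hx y hy n heq hlt
    have h1 := (h x hx (n + 1)).trans (spreadTail_succ_le_sub hβ hp hx.1 hy.1 heq hlt)
    have h2 : β ^ (-(α + η) * ((n + 1 : ℕ) : ℝ))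
        ≤ 1 / C * dist (spreadTail β p x 0) (spreadTail β p y 0) := by
      rw [Real.dist_eq, one_div_mul_eq_div, le_div_iff₀ hC, mul_comm]
      exact h1.trans (le_abs_self _)
    have h3 := Real.rpow_le_rpow (Real.rpow_nonneg hβ0.le _) h2 (show 0 ≤ 1 / (α + η) by positivity)
    rw [Real.mul_rpow (by positivity) dist_nonneg, ← Real.rpow_mul hβ0.le] at h3
    have h4 : -(α + η) * ((n + 1 : ℕ) : ℝ) * (1 / (α + η)) = -((n + 1 : ℕ) : ℝ) := by
      field_simp
    rw [h4, Real.rpow_neg hβ0.le, Real.rpow_natCast] at h3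
    have h5 : dist x y ≤ 1 / β ^ n := by
      have e1 := sub_convergent hβ x n
      have e2 := sub_convergent hβ y n
      rw [convergent_congr β heq] at e1
      have : x - y = ((T β)^[n] x - (T β)^[n] y) / β ^ n := by rw [sub_div]; linarith
      rw [Real.dist_eq, this, abs_div, abs_of_pos (by positivity : 0 < β ^ n)]
      have hx' := iterate_T_mem_Ico β hx.1 n
      have hy' := iterate_T_mem_Ico β hy.1 n
      have : |(T β)^[n] x - (T β)^[n] y| ≤ 1 :=
        abs_le.2 ⟨by linarith [hx'.1, hy'.2], by linarith [hx'.2, hy'.1]⟩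
      gcongr
    calc dist x y ≤ 1 / β ^ n := h5
      _ = β * (β ^ (n + 1))⁻¹ := by rw [pow_succ]; field_simp
      _ ≤ β * ((1 / C) ^ (1 / (α + η))
            * dist (spreadTail β p x 0) (spreadTail β p y 0) ^ (1 / (α + η))) := by gcongr
      _ = _ := by rw [hD]; ring
  refine ⟨D, hD0, fun x hx y hy => ?_⟩
  by_cases hxy : ∃ k, digit β x k ≠ digit β y k
  · obtain ⟨n, heq, hne⟩ := exists_first_digit_ne β hxy
    rcases lt_or_gt_of_ne hne with hlt | hlt
    · rw [dist_comm x, dist_comm (spreadTail β p x 0)]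
      exact key y hy x hx n (fun k hk => (heq k hk).symm) hlt
    · exact key x hx y hy n heq hlt
  · push Not at hxy
    rw [eq_of_digit_eq hβ hx.1 hy.1 hxy]
    simp only [dist_self]
    positivity

lemma ofReal_le_dimH_image_spread (hβ : 1 < β) (hp : StrictMono p) {α c η : ℝ} (hα : 0 < α)
    (hpα : ∀ k, (p k : ℝ) ≤ α * k) (hc : 0 < c) (hη : 0 < η) (hdim : 1 ≤ dimH (slowSet β c)) :
    ENNReal.ofReal (1 / (α + η)) ≤ dimH ((fun x => spreadTail β p x 0) '' slowSet β c) := by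
  obtain ⟨C, hC, h⟩ := exists_dist_le_dist_spread_rpow hβ hp hα hpα hc hη
  set g : ℝ → ℝ := fun x => spreadTail β p x 0 with hg
  have hr : 0 < 1 / (α + η) := by positivity
  have hinj : InjOn g (slowSet β c) := by
    intro x hx y hy hxy
    have := h x hx y hy
    rw [show spreadTail β p x 0 = spreadTail β p y 0 from hxy, dist_self,
      Real.zero_rpow hr.ne', mul_zero] at this
    exact dist_le_zero.1 this
  have hleft := hinj.leftInvOn_invFunOn
  set f := Function.invFunOn g (slowSet β c) with hf
  have hhol : HolderOnWith C.toNNReal (1 / (α + η)).toNNReal f (g '' slowSet β c) := by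
    rintro _ ⟨x, hx, rfl⟩ _ ⟨y, hy, rfl⟩
    rw [hleft hx, hleft hy, edist_dist, edist_dist, Real.coe_toNNReal _ hr.le,
      ENNReal.ofReal_rpow_of_nonneg dist_nonneg hr.le]
    change _ ≤ ENNReal.ofReal C * _
    rw [← ENNReal.ofReal_mul hC.le]
    exact ENNReal.ofReal_le_ofReal (h x hx y hy)
  have h1 := hhol.dimH_image_le (Real.toNNReal_pos.2 hr)
  have h2 : f '' (g '' slowSet β c) = slowSet β c := hleft.image_image
  rw [h2] at h1
  have h3 := (ENNReal.le_div_iff_mul_le (Or.inl (by simpa using hr))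
    (Or.inl ENNReal.coe_ne_top)).1 (hdim.trans h1)
  rwa [one_mul] at h3

end

/-! ### Sparse insertion of long blocks of zeros -/

open Classical in
/-- The largest factorial not exceeding `k`, and `0` if there is none. -/
noncomputable def factorialBelow (k : ℕ) : ℕ := Nat.findGreatest (fun i => ∃ t : ℕ, i = t.factorial) k

/-- The position of the digit with index `k` after a block of about `τ * t!` zeros has been
inserted before the digit with index `t!`, for every `t`. -/
noncomputable def position (τ : ℝ) (k : ℕ) : ℕ := k + ⌊τ * factorialBelow k⌋₊

lemma strictMono_position {τ : ℝ} (hτ : 0 ≤ τ) : StrictMono (position τ) := by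
  classical
  refine strictMono_nat_of_lt_succ fun k => ?_
  have h : factorialBelow k ≤ factorialBelow (k + 1) := Nat.findGreatest_mono_right _ (Nat.le_succ k)
  have h' : (factorialBelow k : ℝ) ≤ factorialBelow (k + 1) := by exact_mod_cast h
  have : ⌊τ * factorialBelow k⌋₊ ≤ ⌊τ * factorialBelow (k + 1)⌋₊ := by gcongr
  simp only [position]
  omega

lemma position_le {τ : ℝ} (hτ : 0 ≤ τ) (k : ℕ) : (position τ k : ℝ) ≤ (1 + τ) * k := by
  classical
  have h : (factorialBelow k : ℝ) ≤ k := by exact_mod_cast Nat.findGreatest_le k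
  have h2 := Nat.floor_le (mul_nonneg hτ (Nat.cast_nonneg (factorialBelow k)))
  have h3 := mul_le_mul_of_nonneg_left h hτ
  simp only [position, Nat.cast_add]
  linarith

lemma factorialBelow_factorial (t : ℕ) : factorialBelow t.factorial = t.factorial := by
  classical
  exact le_antisymm (Nat.findGreatest_le _) (Nat.le_findGreatest le_rfl ⟨t, rfl⟩)

lemma factorialBelow_pred_factorial_le (t : ℕ) :
    factorialBelow ((t + 1).factorial - 1) ≤ t.factorial := by
  classical
  by_cases h0 : factorialBelow ((t + 1).factorial - 1) = 0
  · omega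
  · obtain ⟨s, hs⟩ := (Nat.findGreatest_eq_iff.1 (rfl :
      factorialBelow ((t + 1).factorial - 1) = _)).2.1 h0
    have hle : factorialBelow ((t + 1).factorial - 1) ≤ (t + 1).factorial - 1 :=
      Nat.findGreatest_le _
    have hpos := Nat.factorial_pos (t + 1)
    rw [hs] at hle ⊢
    have hst : s < t + 1 := by
      by_contra! hge
      have := Nat.factorial_le hge
      omega
    exact Nat.factorial_le (by omega)

/-- Before index `(t+1)!` the accumulated shift is at most `τ t!`, negligible against `(t+1)!`;
hence the positions on the two sides of the block have ratio tending to `1 + τ`. -/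
lemma eventually_mul_position_pred_le {τ a : ℝ} (hτ : 0 ≤ τ) (ha0 : 0 < a) (ha : a < 1 + τ) :
    ∀ᶠ t : ℕ in atTop, a * ((position τ ((t + 1).factorial - 1) + 1 : ℕ) : ℝ)
      ≤ position τ (t + 1).factorial := by
  have hgap : 0 < 1 + τ - a := by linarith
  filter_upwards [eventually_ge_atTop ⌈(a * τ + 1) / (1 + τ - a)⌉₊] with t ht
  have ht' : a * τ + 1 ≤ (1 + τ - a) * (t + 1) := by
    have := (Nat.ceil_le.1 ht)
    rw [div_le_iff₀ hgap] at this
    nlinarith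
  have hpos := Nat.factorial_pos (t + 1)
  have hfac : ((t + 1).factorial : ℝ) = (t + 1) * t.factorial := by
    rw [Nat.factorial_succ]; push_cast; ring
  have hone : (1 : ℝ) ≤ t.factorial := by exact_mod_cast Nat.factorial_pos t
  have h1 : ((position τ ((t + 1).factorial - 1) + 1 : ℕ) : ℝ)
      ≤ (t + 1).factorial + τ * t.factorial := by
    have hb : (factorialBelow ((t + 1).factorial - 1) : ℝ) ≤ t.factorial := by
      exact_mod_cast factorialBelow_pred_factorial_le t
    have hfl := Nat.floor_le (mul_nonneg hτ
      (Nat.cast_nonneg (factorialBelow ((t + 1).factorial - 1))))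
    have hmul := mul_le_mul_of_nonneg_left hb hτ
    have he : position τ ((t + 1).factorial - 1) + 1
        = (t + 1).factorial + ⌊τ * factorialBelow ((t + 1).factorial - 1)⌋₊ := by
      simp only [position]
      omega
    rw [he, Nat.cast_add]
    linarith
  have h2 : (1 + τ) * (t + 1).factorial - 1 ≤ position τ (t + 1).factorial := by
    have := Nat.lt_floor_add_one (τ * (t + 1).factorial)
    simp only [position, factorialBelow_factorial, Nat.cast_add]
    linarith
  refine (mul_le_mul_of_nonneg_left h1 ha0.le).trans (le_trans ?_ h2)
  rw [hfac]
  nlinarith [mul_le_mul_of_nonneg_right ht' (zero_le_one.trans hone)]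

lemma spread_mem_levelSet {β : ℝ} (hβ : 1 < β) {τ c x : ℝ} (hτ : 0 ≤ τ) (hc : 0 < c)
    (hx : x ∈ slowSet β c) : spreadTail β (position τ) x 0 ∈ levelSet β (1 + τ) := by
  have hβ0 : 0 < β := by linarith
  have hp := strictMono_position hτ
  refine mem_levelSet_of hβ (by linarith) (spreadTail_zero_mem_Ico hβ hp hx.1) ?_ ?_
  · intro a ha0 ha
    refine frequently_atTop.2 fun N => ?_
    obtain ⟨t, ht, htN⟩ := ((eventually_mul_position_pred_le hτ ha0 ha).and
      (eventually_ge_atTop N)).exists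
    have hpos := Nat.factorial_pos (t + 1)
    -- This order is the start of the block of zeros, where the remainder already equals the tail
    -- after the block.
    refine ⟨position τ ((t + 1).factorial - 1) + 1, ?_, ?_⟩
    · have h1 := Nat.self_le_factorial (t + 1)
      have h2 := hp.le_apply (x := (t + 1).factorial - 1)
      omega
    · rw [sub_convergent_spread hβ hp hx.1 (n := (t + 1).factorial)
        (hp (by omega)) (fun k hk => Nat.lt_succ_of_le (hp.monotone (by omega)))]
      refine (spreadTail_lt hβ hp hx.1 _).trans_le ?_
      rw [one_div, ← Real.rpow_natCast β (position τ _), ← Real.rpow_neg hβ0.le]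
      refine Real.rpow_le_rpow_of_exponent_le hβ.le ?_
      linarith
  · intro a ha
    -- Half of the excess goes into the tail estimate; the other half beats the constant `C`.
    set η := (a - (1 + τ)) / 2 with hη
    have hη0 : 0 < η := by rw [hη]; linarith
    obtain ⟨C, hC, h⟩ := exists_le_spreadTail hβ hp (by linarith) (position_le hτ) hc hη0
    have hlim : Tendsto (fun m : ℕ => (β ^ (-η)) ^ m) atTop (𝓝 0) :=
      tendsto_pow_atTop_nhds_zero_of_lt_one (Real.rpow_nonneg hβ0.le _)
        (Real.rpow_lt_one_of_one_lt_of_neg hβ (by linarith))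
    filter_upwards [hlim.eventually_lt_const hC] with m hm
    classical
    have hex : ∃ n, m ≤ position τ n := ⟨m, hp.le_apply⟩
    have hnm : Nat.find hex ≤ m := Nat.find_min' hex hp.le_apply
    rw [sub_convergent_spread hβ hp hx.1 (Nat.find_spec hex)
      fun k hk => not_le.1 (Nat.find_min hex hk)]
    refine le_trans ?_ (h x hx _)
    calc β ^ (-a * m) = (β ^ (-η)) ^ m * β ^ (-(1 + τ + η) * m) := by
          rw [← Real.rpow_natCast (β ^ (-η)), ← Real.rpow_mul hβ0.le, ← Real.rpow_add hβ0]
          congr 1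
          rw [hη]
          ring
      _ ≤ C * β ^ (-(1 + τ + η) * (Nat.find hex : ℝ)) := by
          have hnm' : ((Nat.find hex : ℕ) : ℝ) ≤ m := by exact_mod_cast hnm
          refine mul_le_mul hm.le (Real.rpow_le_rpow_of_exponent_le hβ.le ?_)
            (Real.rpow_nonneg hβ0.le _) hC.le
          nlinarith

lemma le_dimH_levelSet {β : ℝ} (hβ : 1 < β) {α : ℝ} (hα : 1 ≤ α) :
    ENNReal.ofReal (1 / α) ≤ dimH (levelSet β α) := by
  obtain ⟨c, hc, hdim⟩ := exists_one_le_dimH_slowSet hβ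
  have hτ : 0 ≤ α - 1 := by linarith
  have hsub : (fun x => spreadTail β (position (α - 1)) x 0) '' slowSet β c ⊆ levelSet β α := by
    rintro _ ⟨x, hx, rfl⟩
    have := spread_mem_levelSet hβ hτ hc hx
    rwa [add_sub_cancel] at this
  have hle : ∀ η : ℝ, 0 < η → ENNReal.ofReal (1 / (α + η)) ≤ dimH (levelSet β α) := fun η hη =>
    (ofReal_le_dimH_image_spread hβ (strictMono_position hτ) (by linarith)
      (fun k => by simpa using position_le hτ k) hc hη hdim).trans (dimH_mono hsub)
  have hlim : Tendsto (fun η : ℝ => ENNReal.ofReal (1 / (α + η))) (𝓝[>] 0)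
      (𝓝 (ENNReal.ofReal (1 / α))) := by
    have hcont : ContinuousAt (fun η : ℝ => 1 / (α + η)) 0 :=
      continuousAt_const.div (continuousAt_const.add continuousAt_id) (by simp; linarith)
    have := (ENNReal.continuous_ofReal.continuousAt.comp hcont).tendsto
    simp only [Function.comp_def, add_zero] at this
    exact this.mono_left nhdsWithin_le_nhds
  exact le_of_tendsto hlim (eventually_mem_nhdsWithin.mono fun η hη => hle η hη)

end BetaExpansion

theorem corollary1 (β : ℝ) (hβ : 1 < β) (α : ℝ) :
    (1 ≤ α → dimH (BetaExpansion.levelSet β α) = ENNReal.ofReal (1 / α)) ∧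
      (α < 1 → BetaExpansion.levelSet β α = ∅) :=
  ⟨fun hα => le_antisymm (BetaExpansion.dimH_levelSet_le hβ hα)
    (BetaExpansion.le_dimH_levelSet hβ hα), BetaExpansion.levelSet_eq_empty hβ⟩
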